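/- Let $n\ge 2$, let $\mathbb{D}=\{z\in\mathbb{C}:|z|<1\}$, and let $E^{1,n}=\{[w]\oplus(z\,\mathbb{I}_{n-1}) : z,w\in\mathbb{C}\}\subset\mathbb{C}^{n\times n}$. For $A\in\mathbb{C}^{n\times n}$ put $$\mu_{E^{1,n}}(A)=\Big(\inf\{\|X\| : X\in E^{1,n},\ \mathbb{I}-AX \text{ is singular}\}\Big)^{-1}\in[0,\infty],$$ where $\|\cdot\|$ is the operator norm relative to the Euclidean norm on $\mathbb{C}^n$ and $\mu_{E^{1,n}}(A)=0$ if the set is empty, and let $\Omega_{1,n}=\{W\in\mathbb{C}^{n\times n} : \mu_{E^{1,n}}(W)<1\}$. For $I\subseteq\{1,\dots,n\}$ let $A_I$ be the submatrix of $A$ with rows and columns indexed by $I$, and define $X(A)\in\mathbb{C}^n$ and $Y(A)\in\mathbb{C}^{n-1}$ by $$X_j(A)=\sum_{|I|=j,\ 1\in I}\det(A_I)\quad(1\le j\le n),\qquad Y_j(A)=\sum_{|I|=j,\ 1\notin I}\det(A_I)\quad(1\le j\le n-1).$$ For $(x,y)\in\mathbb{C}^n\times\mathbb{C}^{n-1}$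 let $$P_n(z;x)=\sum_{j=0}^{n-1}(-1)^jx_{j+1}z^j,\qquad Q_n(z;y)=1+\sum_{j=1}^{n-1}(-1)^jy_jz^j,$$ and let $\Psi_n(\cdot\,;x,y)=P_n(\cdot\,;x)/Q_n(\cdot\,;y)$ be the rational function evaluated after all common factors have been cancelled. Let $\zeta_1,\dots,\zeta_M$ be distinct points of $\mathbb{D}$ and let $W_1,\dots,W_M\in\Omega_{1,n}$. If there exists a holomorphic map $F:\mathbb{D}\to\Omega_{1,n}$ with $F(\zeta_j)=W_j$ for $j=1,\dots,M$, then for each $z\in\overline{\mathbb{D}}$ none of the rational functions $\Psi_n(\cdot\,;X(W_j),Y(W_j))$, $1\le j\le M$, has a pole at $z$, and the matrix $$M_z=\left[\frac{1-\overline{\Psi_n(z;X(W_j),Y(W_j))}\,\Psi_n(z;X(W_k),Y(W_k))}{1-\overline{\zeta_j}\,\zeta_k}\right]_{j,k=1}^M$$ is positive semidefinite. -/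

import Mathlib

open scoped ComplexConjugate ComplexOrder

noncomputable section

namespace MuSynthesis

/-- The structured singular value
`μ_E(A) = (inf {‖X‖ : X ∈ E and I - A X is singular})⁻¹`, where `‖X‖` is the operator norm relative
to the Euclidean norm on `ℂⁿ`. It is valued in `[0, ∞]`, so that the infimum over the empty set is
`∞`, and then `μ_E(A) = 0`. -/
def structuredSingularValue {n : ℕ} (E : Submodule ℂ (Matrix (Fin n) (Fin n) ℂ))
    (A : Matrix (Fin n) (Fin n) ℂ) : ENNReal :=
  (⨅ X ∈ {X : Matrix (Fin n) (Fin n) ℂ | X ∈ E ∧ (1 - A * X).det = 0},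
    ‖Matrix.toEuclideanCLM (n := Fin n) (𝕜 := ℂ) X‖ₑ)⁻¹

/-- The unit `μ_E`-ball `Ω_E = {W : μ_E(W) < 1}`. -/
def unitMuBall {n : ℕ} (E : Submodule ℂ (Matrix (Fin n) (Fin n) ℂ)) :
    Set (Matrix (Fin n) (Fin n) ℂ) :=
  {W | structuredSingularValue E W < 1}

/-- The subspace `E^{1,n} = {[w] ⊕ z I_{n-1} : z, w ∈ ℂ}` of the `n × n` matrices. -/
def E1 (n : ℕ) : Submodule ℂ (Matrix (Fin n) (Fin n) ℂ) where
  carrier := {X | ∃ w z : ℂ, X = Matrix.diagonal (fun i : Fin n => if (i : ℕ) = 0 then w else z)}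
  zero_mem' := ⟨0, 0, by simp⟩
  add_mem' := by
    rintro _ _ ⟨w, z, rfl⟩ ⟨w', z', rfl⟩
    refine ⟨w + w', z + z', ?_⟩
    rw [Matrix.diagonal_add]
    congr 1
    ext i
    split_ifs <;> rfl
  smul_mem' := by
    rintro c _ ⟨w, z, rfl⟩
    refine ⟨c * w, c * z, ?_⟩
    rw [← Matrix.diagonal_smul]
    congr 1
    ext i
    simp only [Pi.smul_apply, smul_eq_mul]
    split_ifs <;> rfl

/-- `Ω_{1,n}`, the unit `μ_E`-ball for `E = E^{1,n}`. -/
def Omega1 (n : ℕ) : Set (Matrix (Fin n) (Fin n) ℂ) := unitMuBall (E1 n)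

/-- The principal minor `det (A_I)`, where `A_I` is the submatrix of `A` with rows and columns
indexed by `I`. -/
def principalMinor {n : ℕ} (A : Matrix (Fin n) (Fin n) ℂ) (I : Finset (Fin n)) : ℂ :=
  (A.submatrix (fun i : I => (i : Fin n)) (fun i : I => (i : Fin n))).det

/-- `X_{j+1}(A)`, `0 ≤ j ≤ n - 1`: the sum of the principal minors of size `j + 1` whose index set
contains the first index. -/
def piX {n : ℕ} (A : Matrix (Fin n) (Fin n) ℂ) : Fin n → ℂ := fun j =>
  ∑ I ∈ (Finset.univ.powersetCard (j.val + 1)).filter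
      (fun I : Finset (Fin n) => ∃ i ∈ I, (i : ℕ) = 0), principalMinor A I

/-- `Y_{j+1}(A)`, `0 ≤ j ≤ n - 2`: the sum of the principal minors of size `j + 1` whose index set
does not contain the first index. -/
def piY {n : ℕ} (A : Matrix (Fin n) (Fin n) ℂ) : Fin (n - 1) → ℂ := fun j =>
  ∑ I ∈ (Finset.univ.powersetCard (j.val + 1)).filter
      (fun I : Finset (Fin n) => ∀ i ∈ I, (i : ℕ) ≠ 0), principalMinor A I

/-- The map `π_n = (X, Y) : ℂ^{n × n} → ℂⁿ × ℂ^{n-1}`. -/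
def piMap {n : ℕ} (A : Matrix (Fin n) (Fin n) ℂ) : (Fin n → ℂ) × (Fin (n - 1) → ℂ) :=
  (piX A, piY A)

/-- `P_n(z; x) = ∑_{j=0}^{n-1} (-1)^j x_{j+1} z^j`; the coordinate `x_{j+1}` is `x j`. -/
def polyP {n : ℕ} (x : Fin n → ℂ) : Polynomial ℂ :=
  ∑ j : Fin n, Polynomial.C ((-1) ^ (j : ℕ) * x j) * Polynomial.X ^ (j : ℕ)

/-- `Q_n(z; y) = 1 + ∑_{j=1}^{n-1} (-1)^j y_j z^j`; the coordinate `y_{j+1}` is `y j`. -/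
def polyQ {n : ℕ} (y : Fin (n - 1) → ℂ) : Polynomial ℂ :=
  1 + ∑ j : Fin (n - 1),
    Polynomial.C ((-1) ^ ((j : ℕ) + 1) * y j) * Polynomial.X ^ ((j : ℕ) + 1)

/-- The rational function `Ψ_n(·; x, y) = P_n(·; x) / Q_n(·; y)`. As an element of the field of
rational functions it is represented by coprime `num` and `denom`, and `RatFunc.eval` is
the quotient of their values: all common factors are cancelled before evaluation. -/
def Psi {n : ℕ} (p : (Fin n → ℂ) × (Fin (n - 1) → ℂ)) : RatFunc ℂ :=
  algebraMap (Polynomial ℂ) (RatFunc ℂ) (polyP p.1) /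
    algebraMap (Polynomial ℂ) (RatFunc ℂ) (polyQ p.2)

/-- The value `Ψ_n(z; x, y)`. -/
def PsiAt {n : ℕ} (z : ℂ) (p : (Fin n → ℂ) × (Fin (n - 1) → ℂ)) : ℂ :=
  (Psi p).eval (RingHom.id ℂ) z

/-- The matrix
`[(1 - conj (v_j) v_k) / (1 - conj (ζ_j) ζ_k)]_{j,k}` of nodes `ζ_j` and values `v_j`. -/
def pickMatrix {M : ℕ} (ζ v : Fin M → ℂ) : Matrix (Fin M) (Fin M) ℂ :=
  Matrix.of fun j k => (1 - conj (v j) * v k) / (1 - conj (ζ j) * ζ k)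

end MuSynthesis

end

/-! For `X = [w] ⊕ z I` the determinant `det (1 - A X)` is affine in `w`: it equals `Q(z) - w P(z)`,
with coefficients given by the minors of `A` (`det_one_sub_mul_diagonal`). Membership of `A` in
`Ω_{1,n}` makes it nonzero on the closed bidisc (`eval_polyQ_sub_ne_zero`). Taking `w = 0` excludes
poles; taking `w = Q/P` forces `|P/Q| < 1`. So for each fixed `z` in the closed disc, composing an
interpolant `F` with `A ↦ P(z)/Q(z)` gives a scalar Schur function of `ζ`. The claim is then the
necessity half of Pick's theorem (`pickMatrix_posSemidef`), proved with Szegő kernels and circle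
averages. -/

namespace MuSynthesis

open Metric Real

/-! ### Necessity in Pick's theorem -/

/-- A finite linear combination of Szegő kernels reproduces values under circle averages. -/
lemma circleAverage_conj_kernel_mul {ι : Type*} [Fintype ι] {ζ : ι → ℂ}
    (hζ : ∀ j, ζ j ∈ ball (0 : ℂ) 1) (b : ι → ℂ) {φ : ℂ → ℂ}
    (hφ : DiffContOnCl ℂ φ (ball 0 1)) :
    circleAverage (fun z => conj (∑ j, conj (b j) / (1 - conj (ζ j) * z)) * φ z) 0 1 =
      ∑ j, b j * φ (ζ j) := by
  have hne : ∀ j, ∀ z ∈ sphere (0 : ℂ) 1, z - ζ j ≠ 0 := by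
    intro j z hz h
    have h1 := hζ j
    rw [← sub_eq_zero.1 h, mem_ball, mem_sphere.1 hz] at h1
    exact lt_irrefl _ h1
  have hcont : ContinuousOn φ (sphere (0 : ℂ) 1) :=
    hφ.continuousOn_ball.mono sphere_subset_closedBall
  calc _ = circleAverage (fun z => ∑ j, b j • ((z - 0) / (z - ζ j)) • φ z) 0 1 := by
        -- On the circle `conj z = 1/z`, so the conjugated kernel is `z / (z - ζ j)` and Cauchy's
        -- formula applies.
        refine circleAverage_congr_sphere fun z hz => ?_
        rw [abs_one] at hz
        have hzz : conj z * z = 1 := by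
          rw [← Complex.normSq_eq_conj_mul_self, Complex.normSq_eq_norm_sq,
            mem_sphere_zero_iff_norm.1 hz]
          simp
        simp only [map_sum, map_div₀, map_sub, map_mul, map_one, Complex.conj_conj,
          Finset.sum_mul, smul_eq_mul, sub_zero]
        refine Finset.sum_congr rfl fun j _ => ?_
        have h1 := hne j z hz
        have h2 : (1 - ζ j * conj z) ≠ 0 := by
          intro h
          apply h1
          linear_combination z * h + ζ j * hzz
        rw [← mul_assoc]
        congr 1
        field_simp
        linear_combination (b j * ζ j) * hzz
    _ = _ := by
        rw [circleAverage_fun_sum]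
        · refine Finset.sum_congr rfl fun j _ => ?_
          rw [circleAverage_fun_smul, DiffContOnCl.circleAverage_smul_div (by simpa using hφ)
            (by simpa using hζ j), smul_eq_mul]
        · intro j _
          refine ContinuousOn.circleIntegrable zero_le_one ?_
          have := hne j
          fun_prop (disch := assumption)

lemma isHermitian_pickMatrix {M : ℕ} (ζ v : Fin M → ℂ) : (pickMatrix ζ v).IsHermitian := by
  ext j k
  simp [pickMatrix, mul_comm]

/-- In Hardy space terms, `u` below is a combination of kernels and `g` its image under the adjoint
of multiplication by `f`. The quadratic form is `‖u‖² - ‖g‖²`, nonnegative since `f` is contractive.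
-/
lemma pickMatrix_posSemidef_of_diffContOnCl {M : ℕ} {ζ : Fin M → ℂ}
    (hζ : ∀ j, ζ j ∈ ball (0 : ℂ) 1) {f : ℂ → ℂ} (hf : DiffContOnCl ℂ f (ball 0 1))
    (hf1 : ∀ z ∈ sphere (0 : ℂ) 1, ‖f z‖ ≤ 1) :
    (pickMatrix ζ (fun j => f (ζ j))).PosSemidef := by
  refine .of_dotProduct_mulVec_nonneg (isHermitian_pickMatrix _ _) fun x => ?_
  set S := star x ⬝ᵥ (pickMatrix ζ (fun j => f (ζ j))).mulVec x with hS
  have hre : conj S = S := by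
    rw [hS, ← Complex.star_def, ← Matrix.star_dotProduct, Matrix.star_mulVec, ← Matrix.dotProduct_mulVec, (isHermitian_pickMatrix _ _).eq]
  suffices h : 0 ≤ S.re by
    rw [← Complex.conj_eq_iff_re.1 hre]
    exact_mod_cast h
  have hden : ∀ j, ∀ z ∈ closedBall (0 : ℂ) 1, 1 - conj (ζ j) * z ≠ 0 := by
    intro j z hz h
    have h1 : ‖conj (ζ j) * z‖ = 1 := by rw [← sub_eq_zero.1 h, norm_one]
    have h2 := mem_ball_zero_iff.1 (hζ j)
    have h3 := mem_closedBall_zero_iff.1 hz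
    rw [norm_mul, Complex.norm_conj] at h1
    nlinarith [norm_nonneg z, norm_nonneg (ζ j)]
  have hker : ∀ b : Fin M → ℂ,
      DiffContOnCl ℂ (fun z => ∑ j, conj (b j) / (1 - conj (ζ j) * z)) (ball 0 1) := by
    intro b
    refine ⟨fun z hz => ?_, ?_⟩
    · have := fun j => hden j z (ball_subset_closedBall hz)
      exact DifferentiableWithinAt.fun_sum fun j _ =>
        (differentiableWithinAt_const _).div (by fun_prop) (this j)
    · rw [closure_ball _ one_ne_zero]
      exact continuousOn_finsetSum _ fun j _ =>
        continuousOn_const.div (by fun_prop) (hden j)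
  set u : ℂ → ℂ := fun z => ∑ j, conj (x j) / (1 - conj (ζ j) * z) with hu
  set g : ℂ → ℂ := fun z => ∑ j, conj (x j * f (ζ j)) / (1 - conj (ζ j) * z) with hg
  have hud : DiffContOnCl ℂ u (ball 0 1) := hker x
  have hgd : DiffContOnCl ℂ g (ball 0 1) := hker fun j => x j * f (ζ j)
  have hfg : DiffContOnCl ℂ (fun z => f z * g z) (ball 0 1) := hf.smul hgd
  have e1 := circleAverage_conj_kernel_mul hζ x hud
  have e2 := circleAverage_conj_kernel_mul hζ (fun j => x j * f (ζ j)) hgd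
  have e3 := circleAverage_conj_kernel_mul hζ x hfg
  have cont : ∀ {h : ℂ → ℂ}, DiffContOnCl ℂ h (ball 0 1) →
      ContinuousOn h (sphere (0 : ℂ) 1) := by
    intro h hh
    exact hh.continuousOn_ball.mono sphere_subset_closedBall
  have integ : ∀ {h k : ℂ → ℂ}, DiffContOnCl ℂ h (ball 0 1) → DiffContOnCl ℂ k (ball 0 1) →
      CircleIntegrable (fun z => conj (h z) * k z) 0 1 := by
    intro h k hh hk
    refine ContinuousOn.circleIntegrable zero_le_one ?_
    exact (Complex.continuous_conj.comp_continuousOn (cont hh)).mul (cont hk)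
  have i1 := integ hud hud
  have i2 := integ hgd hgd
  have i3 := integ hud hfg
  have hSum : S = ∑ j, x j * u (ζ j) - ∑ j, x j * f (ζ j) * g (ζ j) := by
    rw [hS, hu, hg]
    simp only [dotProduct, Matrix.mulVec, pickMatrix, Matrix.of_apply, Pi.star_apply,
      Complex.star_def, Finset.mul_sum, ← Finset.sum_sub_distrib]
    rw [Finset.sum_comm]
    refine Finset.sum_congr rfl fun k _ => Finset.sum_congr rfl fun j _ => ?_
    rw [map_mul]
    ring
  have i12 : CircleIntegrable (fun z => conj (u z) * u z + conj (g z) * g z) 0 1 := i1.add i2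
  have i4 : CircleIntegrable (fun z => (2 : ℂ) • (conj (u z) * (f z * g z))) 0 1 := i3.const_smul
  -- The averages of `conj u * (f * g)` and `|g|²` coincide, so subtracting the former twice leaves
  -- `‖u‖² - ‖g‖²`. The real part of the integrand is at least `(|u| - |g|)²`.
  have hAvg : S = circleAverage (fun z => (conj (u z) * u z + conj (g z) * g z) -
      (2 : ℂ) • (conj (u z) * (f z * g z))) 0 1 := by
    rw [circleAverage_fun_sub i12 i4, circleAverage_fun_add i1 i2,
      circleAverage_fun_smul, e1, e2, e3, hSum, smul_eq_mul]
    simp only [← mul_assoc]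
    ring
  have hint : CircleIntegrable (fun z => (conj (u z) * u z + conj (g z) * g z) -
      (2 : ℂ) • (conj (u z) * (f z * g z))) 0 1 := i12.sub i4
  rw [hAvg]
  rw [← Complex.reCLM_apply]
  rw [← ContinuousLinearMap.circleAverage_comp_comm _ hint]
  refine circleAverage_nonneg_of_nonneg fun z hz => ?_
  rw [abs_one] at hz
  have h1 : (conj (u z) * (f z * g z)).re ≤ ‖u z‖ * ‖g z‖ := by
    refine (Complex.re_le_norm _).trans ?_
    rw [norm_mul, norm_mul, Complex.norm_conj]
    gcongr
    exact mul_le_of_le_one_left (norm_nonneg _) (hf1 z hz)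
  have h2 : ∀ w : ℂ, (conj w * w).re = ‖w‖ ^ 2 := by
    intro w
    rw [← Complex.normSq_eq_conj_mul_self, Complex.normSq_eq_norm_sq, Complex.ofReal_re]
  simp only [Function.comp, Complex.reCLM_apply, Complex.sub_re, Complex.add_re, h2, smul_eq_mul,
    Complex.mul_re (2 : ℂ), Complex.re_ofNat, Complex.im_ofNat, zero_mul, sub_zero]
  nlinarith [sq_nonneg (‖u z‖ - ‖g z‖)]

open Filter Topology in
/-- Necessity in Pick's theorem: the Pick matrix of a Schur function is positive semidefinite. -/
theorem pickMatrix_posSemidef {M : ℕ} {ζ : Fin M → ℂ} (hζ : ∀ j, ζ j ∈ ball (0 : ℂ) 1)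
    {f : ℂ → ℂ} (hf : DifferentiableOn ℂ f (ball 0 1)) (hf1 : ∀ z ∈ ball (0 : ℂ) 1, ‖f z‖ ≤ 1) :
    (pickMatrix ζ (fun j => f (ζ j))).PosSemidef := by
  have hr : ∀ r ∈ Set.Ioo (0 : ℝ) 1, ∀ z ∈ closedBall (0 : ℂ) 1, (r : ℂ) * z ∈ ball (0 : ℂ) 1 := by
    intro r hr z hz
    rw [mem_closedBall_zero_iff] at hz
    rw [mem_ball_zero_iff, norm_mul, Complex.norm_real, norm_of_nonneg hr.1.le]
    nlinarith [hr.1, hr.2, norm_nonneg z]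
  -- The dilations `f (r z)` are holomorphic past the closed disc; positivity survives `r → 1`.
  have key : ∀ r ∈ Set.Ioo (0 : ℝ) 1,
      (pickMatrix ζ (fun j => f ((r : ℂ) * ζ j))).PosSemidef := by
    intro r hr'
    refine pickMatrix_posSemidef_of_diffContOnCl (f := fun z => f ((r : ℂ) * z)) hζ ?_
      fun z hz => hf1 _ (hr r hr' z (sphere_subset_closedBall hz))
    refine DifferentiableOn.diffContOnCl ?_
    rw [closure_ball _ one_ne_zero]
    exact hf.comp (by fun_prop) (hr r hr')
  refine .of_dotProduct_mulVec_nonneg (isHermitian_pickMatrix _ _) fun x => ?_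
  have hv : ∀ j, Tendsto (fun r : ℝ => f ((r : ℂ) * ζ j)) (𝓝[<] 1) (𝓝 (f (ζ j))) := by
    intro j
    refine (hf.continuousOn.continuousAt (isOpen_ball.mem_nhds (hζ j))).tendsto.comp ?_
    have : Continuous fun r : ℝ => (r : ℂ) * ζ j := by fun_prop
    simpa using (this.tendsto 1).mono_left nhdsWithin_le_nhds
  have hform : Continuous fun v : Fin M → ℂ => star x ⬝ᵥ (pickMatrix ζ v).mulVec x := by
    simp only [dotProduct, Matrix.mulVec, pickMatrix, Matrix.of_apply, div_eq_mul_inv]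
    fun_prop
  refine ge_of_tendsto ((hform.tendsto _).comp (tendsto_pi_nhds.2 hv)) ?_
  filter_upwards [Ioo_mem_nhdsLT (zero_lt_one (α := ℝ))] with r hr'
  exact (key r hr').dotProduct_mulVec_nonneg x

/-! ### The determinant as a pencil in principal minors -/

/-- The determinant of `1 + N` is the sum of all principal minors of `N`. -/
lemma det_one_add_eq_sum_principalMinor {n : ℕ} (N : Matrix (Fin n) (Fin n) ℂ) :
    (1 + N).det = ∑ I : Finset (Fin n), principalMinor N I := by
  rw [add_comm]
  -- Multilinearity in the rows: each `I` records which rows come from `N`.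
  refine (Matrix.detRowAlternating.map_add_univ N.row (1 : Matrix (Fin n) (Fin n) ℂ).row).trans ?_
  exact Finset.sum_congr rfl fun I _ => Matrix.det_piecewise_one_eq_submatrix_det N I

lemma principalMinor_neg_mul_diagonal {n : ℕ} (A : Matrix (Fin n) (Fin n) ℂ) (d : Fin n → ℂ)
    (I : Finset (Fin n)) :
    principalMinor (-(A * Matrix.diagonal d)) I =
      (-1) ^ I.card * (∏ i ∈ I, d i) * principalMinor A I := by
  have : (-(A * Matrix.diagonal d)).submatrix (fun i : I => (i : Fin n)) (fun i : I => (i : Fin n))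
      = -(A.submatrix (fun i : I => (i : Fin n)) (fun i : I => (i : Fin n)) *
        Matrix.diagonal fun i : I => d i) := by
    ext i j
    simp
  rw [principalMinor, this, Matrix.det_neg, Matrix.det_mul, Matrix.det_diagonal, principalMinor,
    Finset.prod_coe_sort I d, Fintype.card_coe]
  ring

lemma eval_polyP_piX {n : ℕ} (A : Matrix (Fin n) (Fin n) ℂ) (z : ℂ) :
    (polyP (piX A)).eval z = ∑ I : Finset (Fin n) with ∃ i : Fin n, i ∈ I ∧ (i : ℕ) = 0,
      (-1) ^ (I.card - 1) * z ^ (I.card - 1) * principalMinor A I := by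
  simp only [polyP, piX, Polynomial.eval_finsetSum, Polynomial.eval_mul, Polynomial.eval_C,
    Polynomial.eval_pow, Polynomial.eval_X, Finset.mul_sum, Finset.sum_mul]
  have hcard : ∀ I : Finset (Fin n), (∃ i ∈ I, (i : ℕ) = 0) → 1 ≤ I.card ∧ I.card ≤ n := by
    rintro I ⟨i, hi, -⟩
    exact ⟨Finset.card_pos.2 ⟨i, hi⟩, by simpa using I.card_le_univ⟩
  rw [Finset.sum_sigma']
  refine Finset.sum_bij' (fun p _ => p.2)
    (fun I hI => ⟨⟨I.card - 1, ?_⟩, I⟩) ?_ ?_ ?_ ?_ ?_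
  · have := hcard I (Finset.mem_filter.1 hI).2
    omega
  · rintro ⟨j, I⟩ h
    simp only [Finset.mem_sigma, Finset.mem_filter, Finset.mem_univ, true_and] at h ⊢
    exact h.2
  · intro I hI
    have := hcard I (Finset.mem_filter.1 hI).2
    simp only [Finset.mem_sigma, Finset.mem_filter, Finset.mem_univ, true_and,
      Finset.mem_powersetCard, Finset.subset_univ] at hI ⊢
    exact ⟨by omega, hI⟩
  · rintro ⟨⟨j, hj⟩, I⟩ h
    simp only [Finset.mem_sigma, Finset.mem_filter, Finset.mem_univ, true_and,
      Finset.mem_powersetCard, Finset.subset_univ] at h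
    obtain ⟨h, -⟩ := h
    simp [h]
  · intro I _
    rfl
  · rintro ⟨⟨j, hj⟩, I⟩ h
    simp only [Finset.mem_sigma, Finset.mem_filter, Finset.mem_univ, true_and,
      Finset.mem_powersetCard, Finset.subset_univ] at h
    obtain ⟨h, -⟩ := h
    simp only [h, Nat.add_sub_cancel]
    ring

lemma eval_polyQ_piY {n : ℕ} (hn : n ≠ 0) (A : Matrix (Fin n) (Fin n) ℂ) (z : ℂ) :
    (polyQ (piY A)).eval z = ∑ I : Finset (Fin n) with ¬∃ i : Fin n, i ∈ I ∧ (i : ℕ) = 0,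
      (-1) ^ I.card * z ^ I.card * principalMinor A I := by
  simp only [polyQ, piY, Polynomial.eval_add, Polynomial.eval_one, Polynomial.eval_finsetSum,
    Polynomial.eval_mul, Polynomial.eval_C, Polynomial.eval_pow, Polynomial.eval_X, Finset.mul_sum,
    Finset.sum_mul]
  have hmem : (∅ : Finset (Fin n)) ∈
      Finset.univ.filter fun I : Finset (Fin n) => ¬∃ i ∈ I, (i : ℕ) = 0 := by simp
  have hempty : principalMinor A ∅ = 1 := Matrix.det_isEmpty
  -- The constant term 1 of `Q` is the empty minor.
  rw [← Finset.add_sum_erase _ _ hmem, hempty]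
  simp only [Finset.card_empty, pow_zero, mul_one]
  congr 1
  have hcard : ∀ I : Finset (Fin n), I ≠ ∅ → (∀ i ∈ I, (i : ℕ) ≠ 0) →
      1 ≤ I.card ∧ I.card < n := by
    intro I hI h
    refine ⟨Finset.card_pos.2 (Finset.nonempty_iff_ne_empty.2 hI), ?_⟩
    have : I ⊂ Finset.univ := by
      refine Finset.ssubset_univ_iff.2 ?_
      rintro rfl
      exact h ⟨0, Nat.pos_of_ne_zero hn⟩ (Finset.mem_univ _) rfl
    simpa using Finset.card_lt_card this
  rw [Finset.sum_sigma']
  refine Finset.sum_bij' (fun p _ => p.2)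
    (fun I hI => ⟨⟨I.card - 1, ?_⟩, I⟩) ?_ ?_ ?_ ?_ ?_
  · simp only [Finset.mem_erase, Finset.mem_filter, Finset.mem_univ, true_and, not_exists,
      not_and] at hI
    have := hcard I hI.1 hI.2
    omega
  · rintro ⟨j, I⟩ h
    simp only [Finset.mem_sigma, Finset.mem_filter, Finset.mem_univ, true_and, Finset.mem_erase,
      Finset.mem_powersetCard, Finset.subset_univ, not_exists, not_and] at h ⊢
    refine ⟨?_, h.2⟩
    rintro rfl
    simp at h
  · intro I hI
    simp only [Finset.mem_sigma, Finset.mem_filter, Finset.mem_univ, true_and, Finset.mem_erase,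
      Finset.mem_powersetCard, Finset.subset_univ, not_exists, not_and] at hI ⊢
    have := hcard I hI.1 hI.2
    exact ⟨by omega, hI.2⟩
  · rintro ⟨⟨j, hj⟩, I⟩ h
    simp only [Finset.mem_sigma, Finset.mem_filter, Finset.mem_univ, true_and,
      Finset.mem_powersetCard, Finset.subset_univ] at h
    obtain ⟨h, -⟩ := h
    simp [h]
  · intro I _
    rfl
  · rintro ⟨⟨j, hj⟩, I⟩ h
    simp only [Finset.mem_sigma, Finset.mem_filter, Finset.mem_univ, true_and,
      Finset.mem_powersetCard, Finset.subset_univ] at h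
    obtain ⟨h, -⟩ := h
    simp only [h]
    ring

/-- `det (1 - A X) = Q_n(z) - w P_n(z)` for `X = [w] ⊕ z I`. -/
lemma det_one_sub_mul_diagonal {n : ℕ} (hn : n ≠ 0) (A : Matrix (Fin n) (Fin n) ℂ) (w z : ℂ) :
    (1 - A * Matrix.diagonal (fun i : Fin n => if (i : ℕ) = 0 then w else z)).det =
      (polyQ (piY A)).eval z - w * (polyP (piX A)).eval z := by
  rw [sub_eq_add_neg, det_one_add_eq_sum_principalMinor, eval_polyP_piX, eval_polyQ_piY hn,
    ← Finset.sum_filter_not_add_sum_filter _ (fun I : Finset (Fin n) => ∃ i ∈ I, (i : ℕ) = 0),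
    Finset.mul_sum, sub_eq_add_neg, ← Finset.sum_neg_distrib]
  congr 1
  · refine Finset.sum_congr rfl fun I hI => ?_
    simp only [Finset.mem_filter, Finset.mem_univ, true_and, not_exists, not_and] at hI
    rw [principalMinor_neg_mul_diagonal, Finset.prod_congr rfl fun i hi => if_neg (hI i hi),
      Finset.prod_const]
  · refine Finset.sum_congr rfl fun I hI => ?_
    obtain ⟨i, hi, h0⟩ := (Finset.mem_filter.1 hI).2
    -- Only the first index contributes `w`, which is why the pencil has degree one in `w`.
    have hprod : ∏ j ∈ I.erase i, (if (j : ℕ) = 0 then w else z) = z ^ (I.card - 1) := by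
      rw [← Finset.card_erase_of_mem hi, ← Finset.prod_const]
      refine Finset.prod_congr rfl fun j hj => if_neg fun hj0 => Finset.ne_of_mem_erase hj ?_
      exact Fin.ext (hj0.trans h0.symm)
    obtain ⟨c, hc⟩ := Nat.exists_eq_succ_of_ne_zero (Finset.card_ne_zero_of_mem hi)
    rw [principalMinor_neg_mul_diagonal, ← Finset.mul_prod_erase _ _ hi, hprod, if_pos h0, hc,
      Nat.succ_sub_one, pow_succ]
    ring

/-! ### Consequences of membership in the `μ`-ball -/

open scoped Matrix.Norms.L2Operator in
/-- On `Ω_{1,n}` the pencil `Q_n - w P_n` has no zeros in the closed bidisc. -/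
lemma eval_polyQ_sub_ne_zero {n : ℕ} (hn : n ≠ 0) {A : Matrix (Fin n) (Fin n) ℂ}
    (hA : A ∈ Omega1 n) {w z : ℂ} (hw : ‖w‖ ≤ 1) (hz : ‖z‖ ≤ 1) :
    (polyQ (piY A)).eval z - w * (polyP (piX A)).eval z ≠ 0 := by
  intro h
  rw [← det_one_sub_mul_diagonal hn] at h
  have hA' : structuredSingularValue (E1 n) A < 1 := hA
  -- `μ < 1` says the infimum exceeds 1, so a singularizing `X` of norm at most 1 is a
  -- contradiction.
  rw [structuredSingularValue, ENNReal.inv_lt_one] at hA'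
  refine hA'.not_ge ((iInf₂_le _ ⟨⟨w, z, rfl⟩, h⟩).trans ?_)
  have hnorm : ‖Matrix.toEuclideanCLM (n := Fin n) (𝕜 := ℂ)
      (Matrix.diagonal fun i : Fin n => if (i : ℕ) = 0 then w else z)‖ ≤ 1 := by
    rw [Matrix.l2_opNorm_toEuclideanCLM, Matrix.l2_opNorm_diagonal]
    refine (pi_norm_le_iff_of_nonneg zero_le_one).2 fun i => ?_
    split_ifs
    exacts [hw, hz]
  rw [← ofReal_norm]
  exact ENNReal.ofReal_le_one.2 hnorm

lemma eval_polyQ_ne_zero {n : ℕ} (hn : n ≠ 0) {A : Matrix (Fin n) (Fin n) ℂ}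
    (hA : A ∈ Omega1 n) {z : ℂ} (hz : ‖z‖ ≤ 1) : (polyQ (piY A)).eval z ≠ 0 := by
  simpa using eval_polyQ_sub_ne_zero hn hA (w := 0) (by simp) hz

lemma norm_polyP_div_polyQ_lt_one {n : ℕ} (hn : n ≠ 0) {A : Matrix (Fin n) (Fin n) ℂ}
    (hA : A ∈ Omega1 n) {z : ℂ} (hz : ‖z‖ ≤ 1) :
    ‖(polyP (piX A)).eval z / (polyQ (piY A)).eval z‖ < 1 := by
  by_contra! h
  set r := (polyP (piX A)).eval z / (polyQ (piY A)).eval z with hr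
  have hQ := eval_polyQ_ne_zero hn hA hz
  have hP : (polyP (piX A)).eval z = r * (polyQ (piY A)).eval z := by rw [hr, div_mul_cancel₀ _ hQ]
  have hr0 : r ≠ 0 := norm_pos_iff.1 (zero_lt_one.trans_le h)
  -- If `|P/Q| ≥ 1`, then `w = Q/P` lies in the closed disc and annihilates the pencil.
  refine eval_polyQ_sub_ne_zero hn hA (w := r⁻¹) ?_ hz ?_
  · rw [norm_inv]
    exact inv_le_one_of_one_le₀ h
  · rw [hP, inv_mul_cancel_left₀ hr0, sub_self]

/-- The reduced denominator divides `Q`, so cancellation creates no new poles. -/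
lemma eval_denom_Psi_ne_zero {n : ℕ} {p : (Fin n → ℂ) × (Fin (n - 1) → ℂ)} {z : ℂ}
    (h : (polyQ p.2).eval z ≠ 0) : (Psi p).denom.eval z ≠ 0 := by
  intro h0
  exact h (Polynomial.eval_eq_zero_of_dvd_of_eval_eq_zero (RatFunc.denom_div_dvd _ _) h0)

lemma PsiAt_eq_div {n : ℕ} {p : (Fin n → ℂ) × (Fin (n - 1) → ℂ)} {z : ℂ}
    (h : (polyQ p.2).eval z ≠ 0) : PsiAt z p = (polyP p.1).eval z / (polyQ p.2).eval z := by
  have hQ : polyQ p.2 ≠ 0 := by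
    intro h0
    simp [h0] at h
  have hmul : (Psi p).num * polyQ p.2 = polyP p.1 * (Psi p).denom :=
    (RatFunc.num_mul_eq_mul_denom_iff hQ).2 rfl
  have := congrArg (Polynomial.eval z) hmul
  rw [Polynomial.eval_mul, Polynomial.eval_mul] at this
  rw [PsiAt, RatFunc.eval, Polynomial.eval₂_id, Polynomial.eval₂_id,
    div_eq_div_iff (eval_denom_Psi_ne_zero h) h, this]

section Differentiability

variable {n : ℕ} {F : ℂ → Matrix (Fin n) (Fin n) ℂ} {s : Set ℂ}

lemma differentiableOn_principalMinor (hF : DifferentiableOn ℂ F s) (I : Finset (Fin n)) :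
    DifferentiableOn ℂ (fun ζ => principalMinor (F ζ) I) s := by
  have hentry : ∀ i j, DifferentiableOn ℂ (fun ζ => F ζ i j) s := fun i j =>
    differentiableOn_pi.1 (differentiableOn_pi.1 (show DifferentiableOn ℂ
      (fun ζ => (F ζ : Fin n → Fin n → ℂ)) s from hF) i) j
  simp only [principalMinor, Matrix.det_apply, Matrix.submatrix_apply]
  refine DifferentiableOn.fun_sum fun σ _ => DifferentiableOn.const_smul ?_ _
  exact DifferentiableOn.fun_finsetProd fun i _ => hentry _ _

lemma differentiableOn_eval_polyP (hF : DifferentiableOn ℂ F s) (z : ℂ) :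
    DifferentiableOn ℂ (fun ζ => (polyP (piX (F ζ))).eval z) s := by
  simp only [eval_polyP_piX]
  exact DifferentiableOn.fun_sum fun I _ => (differentiableOn_principalMinor hF I).const_mul _

lemma differentiableOn_eval_polyQ (hn : n ≠ 0) (hF : DifferentiableOn ℂ F s) (z : ℂ) :
    DifferentiableOn ℂ (fun ζ => (polyQ (piY (F ζ))).eval z) s := by
  simp only [eval_polyQ_piY hn]
  exact DifferentiableOn.fun_sum fun I _ => (differentiableOn_principalMinor hF I).const_mul _

end Differentiability

end MuSynthesis

theorem theorem1p3 (n : ℕ) (hn : 2 ≤ n) (M : ℕ)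
    (ζ : Fin M → ℂ) (hζ : ∀ j, ζ j ∈ Metric.ball (0 : ℂ) 1) (hζ_inj : Function.Injective ζ)
    (W : Fin M → Matrix (Fin n) (Fin n) ℂ) (hW : ∀ j, W j ∈ MuSynthesis.Omega1 n)
    (hF : ∃ F : ℂ → Matrix (Fin n) (Fin n) ℂ,
      DifferentiableOn ℂ F (Metric.ball (0 : ℂ) 1) ∧
      Set.MapsTo F (Metric.ball (0 : ℂ) 1) (MuSynthesis.Omega1 n) ∧
      ∀ j, F (ζ j) = W j) :
    ∀ z ∈ Metric.closedBall (0 : ℂ) 1,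
      (∀ j, (MuSynthesis.Psi (MuSynthesis.piMap (W j))).denom.eval z ≠ 0) ∧
      (MuSynthesis.pickMatrix ζ
        (fun j => MuSynthesis.PsiAt z (MuSynthesis.piMap (W j)))).PosSemidef := by
  obtain ⟨F, hFd, hFm, hFW⟩ := hF
  have hn0 : n ≠ 0 := by omega
  intro z hz
  rw [mem_closedBall_zero_iff] at hz
  have hQ : ∀ j, (MuSynthesis.polyQ (MuSynthesis.piMap (W j)).2).eval z ≠ 0 := fun j =>
    MuSynthesis.eval_polyQ_ne_zero hn0 (hW j) hz
  refine ⟨fun j => MuSynthesis.eval_denom_Psi_ne_zero (hQ j), ?_⟩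
  -- The Schur function is in the variable of `F`; `z` is a fixed parameter, so `|z| = 1` is
  -- harmless.
  have hpick := MuSynthesis.pickMatrix_posSemidef hζ
    ((MuSynthesis.differentiableOn_eval_polyP hFd z).fun_div
      (MuSynthesis.differentiableOn_eval_polyQ hn0 hFd z)
      fun _ hx => MuSynthesis.eval_polyQ_ne_zero hn0 (hFm hx) hz)
    fun _ hx => (MuSynthesis.norm_polyP_div_polyQ_lt_one hn0 (hFm hx) hz).le
  simp only [hFW] at hpick
  simp only [fun j => MuSynthesis.PsiAt_eq_div (hQ j)]
  exact hpick
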